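/- Definitions. Let $X$ be a (real) vector lattice; write $x\perp y$ if $|x|\wedge|y|=0$, and $x\perp B$ if $x\perp b$ for all $b\in B$. A band is an order ideal (solid linear subspace) closed under all suprema existing in $X$. A set $D$ of nonzero elements of $X$ is a *$d$-independent system* if for every band $B$, every finite $F\subseteq D$ and every choice of nonzero scalars $c_d$ ($d\in F$), $\sum_{d\in F}c_d d\perp B$ implies $d\perp B$ for all $d\in F$; it is *maximal* if it is maximal under inclusion among such systems. A *full system* of pairwise disjoint bands is a set $\mathcal B$ of pairwise disjoint bands such that only $0$ is disjoint from all $B\in\mathcal B$. An element $x\in X$ is a *$d$-linear combination* of $D$ if there are a full system $\mathcal B$ of pairwise disjoint bands and linear combinations $y_B$ ($B\in\mathcal B$) of members of $D$ such that $x-y_B\perp B$ for every $B\in\mathcal B$. A $d$-independent system $D$ is a *$d$-basis* if every $x\in X$ is a $d$-linear combination of $D$. An *$F$-space* is a Tychonoff space in which any two disjoint cozero sets are completely separated. For a continuous real-valued function $g$ on $K$ put $\Omega_g=\bigcup_{t\in\mathbb R}\operatorname{Int} g^{-1}(t)$. The space $K$. Let $\mathbf S=\omega\times[0,1]^2$ with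 Čech–Stone compactification $\beta\mathbf S$, let $\beta\pi:\beta\mathbf S\to\beta\omega$ extend $\pi(n,x,y)=n$, and let $\beta f:\beta\mathbf S\to[0,1]$ extend $f(n,x,y)=x$. For a free ultrafilter $u$ on $\omega$ let $S_u=(\beta\pi)^{-1}(u)$ and $B_u=S_u\cap\operatorname{cl}(\omega\times[0,1]\times\{0\})$. Put $X_0=S_u$, let $X_{\alpha+1}$ be $X_\alpha$ minus the union over $t\in[0,1]$ of the interiors, in $X_\alpha$, of the sets $\{p\in X_\alpha:\beta f(p)=t\}$, and let $X_\alpha=\bigcap_{\beta<\alpha}X_\beta$ for limit $\alpha$. Let $\delta$ be the least ordinal with $X_\delta=X_{\delta+1}$ (it exists), and put $K=K_u=B_u\cup X_\delta$ and $g=g_u=\beta f\restriction K$. Theorem. (1) If $K$ is any compact Hausdorff connected $F$-space and $g\in C(K)$ is such that $\Omega_g$ is not dense in $K$, then the singleton $\{\mathbf 1\}$ consisting of the constant function $1$ is a maximal $d$-independent system in the vector lattice $C(K)$, but $g$ is not a $d$-linear combination of $\{\mathbf 1\}$; in particular $\{\mathbf 1\}$ is not a $d$-basis. (2) For every free ultrafilter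 $u$ on $\omega$, the space $K_u$ is a compact Hausdorff connected $F$-space and $\Omega_{g_u}$ is not dense in $K_u$. Hence $\{\mathbf 1\}$ is a maximal $d$-independent system in $C(K_u)$, $g_u$ is not a $d$-linear combination of $\{\mathbf 1\}$, and $\{\mathbf 1\}$ is not a $d$-basis of $C(K_u)$. (3) Consequently it is not true that in every vector lattice every maximal $d$-independent system is a $d$-basis. -/

import Mathlib

open Set Topology

noncomputable section

namespace VectorLattice

section Lattice

variable {X : Type*} [AddCommGroup X] [Lattice X] [Module ℝ X]

/-- `x ⊥ y`: lattice disjointness of two elements. -/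
def Disj (x y : X) : Prop := |x| ⊓ |y| = 0

/-- `x ⊥ B`: the element `x` is disjoint from every element of `B`. -/
def DisjSet (x : X) (B : Set X) : Prop := ∀ b ∈ B, Disj x b

/-- A band: a solid linear subspace (order ideal) that contains every supremum, existing in `X`,
of a subset of it. -/
structure IsBand (B : Submodule ℝ X) : Prop where
  solid : ∀ x ∈ B, ∀ y : X, |y| ≤ |x| → y ∈ B
  lub_mem : ∀ s : Set X, s ⊆ B → ∀ a : X, IsLUB s a → a ∈ B

/-- A full system of pairwise disjoint bands: distinct members are disjoint, and only `0` is
disjoint from all members. -/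
structure IsFullDisjointSystem (𝓑 : Set (Submodule ℝ X)) : Prop where
  isBand : ∀ B ∈ 𝓑, IsBand B
  disj : ∀ B ∈ 𝓑, ∀ B' ∈ 𝓑, B ≠ B' → ∀ x ∈ B, DisjSet x (B' : Set X)
  full : ∀ x : X, (∀ B ∈ 𝓑, DisjSet x (B : Set X)) → x = 0

/-- A `d`-independent system: a set of nonzero elements such that, for every band `B`, every
finite `F ⊆ D` and every choice of nonzero scalars `c d` (`d ∈ F`), the relation
`∑ d ∈ F, c d • d ⊥ B` implies `d ⊥ B` for all `d ∈ F`. -/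
structure IsDIndependent (D : Set X) : Prop where
  ne_zero : ∀ d ∈ D, d ≠ 0
  disj : ∀ B : Submodule ℝ X, IsBand B → ∀ F : Finset X, (F : Set X) ⊆ D →
    ∀ c : X → ℝ, (∀ d ∈ F, c d ≠ 0) → DisjSet (∑ d ∈ F, c d • d) (B : Set X) →
      ∀ d ∈ F, DisjSet d (B : Set X)

/-- `x` is a "`d`-linear combination" of members of `D`: there are a full system of pairwise
disjoint bands and linear combinations `y B` of members of `D` with `x - y B ⊥ B` for each
band `B` of the system. -/
def IsDCombination (D : Set X) (x : X) : Prop :=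
  ∃ 𝓑 : Set (Submodule ℝ X), IsFullDisjointSystem 𝓑 ∧
    ∃ y : Submodule ℝ X → X, ∀ B ∈ 𝓑,
      y B ∈ Submodule.span ℝ D ∧ DisjSet (x - y B) (B : Set X)

/-- A `d`-basis: a `d`-independent system of which every element is a `d`-linear combination. -/
def IsDBasis (D : Set X) : Prop :=
  IsDIndependent D ∧ ∀ x : X, IsDCombination D x

end Lattice

end VectorLattice

namespace ConnectedFSpace

/-- `F`-spaces: Tychonoff spaces in which disjoint cozero sets are completely separated. -/
def IsFSpace (X : Type*) [TopologicalSpace X] : Prop :=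
  T35Space X ∧ ∀ a b : C(X, ℝ), (∀ x, a x = 0 ∨ b x = 0) →
    ∃ h : C(X, ℝ), (∀ x, a x ≠ 0 → h x = 0) ∧ (∀ x, b x ≠ 0 → h x = 1)

/-- `Ω_f`, the union of the interiors of the fibers of `f`. -/
def Omega {X : Type*} [TopologicalSpace X] (f : X → ℝ) : Set X :=
  ⋃ t : ℝ, interior (f ⁻¹' {t})

/-- The product `ω × [0,1]²`. -/
abbrev SS : Type := ℕ × unitInterval × unitInterval

/-- The extension `βπ : β(ω × [0,1]²) → βω` of the projection; `βω` is the space of ultrafilters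
on `ℕ`, with `n ∈ ω` identified with the principal ultrafilter `pure n`. -/
def betaPi : StoneCech SS → Ultrafilter ℕ :=
  stoneCechExtend (g := fun p : SS => (pure p.1 : Ultrafilter ℕ))
    (continuous_of_discreteTopology.comp continuous_fst)

/-- The fiber `S_u` of `βπ` over `u`. -/
def fiber (u : Ultrafilter ℕ) : Set (StoneCech SS) := betaPi ⁻¹' {u}

/-- The extension `βf` of `f (n, x, y) = x`. -/
def betaF : StoneCech SS → unitInterval :=
  stoneCechExtend (g := fun p : SS => p.2.1) (continuous_fst.comp continuous_snd)

/-- The bottom line `B_u`: the part of the closure of `ω × [0,1] × {0}` lying in `S_u`. -/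
def bottom (u : Ultrafilter ℕ) : Set (StoneCech SS) :=
  fiber u ∩ closure (stoneCechUnit '' {p : SS | p.2.2 = 0})

/-- `A ∖ ⋃ t, Int_A ((βf ↾ A)⁻¹ t)`, where `Int_A` is the interior operator of the subspace `A`. -/
def trim (A : Set (StoneCech SS)) : Set (StoneCech SS) :=
  A \ ⋃ t : unitInterval, ((↑) : A → StoneCech SS) '' interior {p : A | betaF p = t}

/-- The transfinite sequence `X_0 = S_u`, `X_{α+1} = trim X_α`, `X_α = ⋂ β < α, X_β` for
limit `α`. -/
def seq (u : Ultrafilter ℕ) (α : Ordinal.{0}) : Set (StoneCech SS) :=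
  Ordinal.limitRecOn α (fiber u) (fun _ A => trim A) (fun α _ A => ⋂ (β) (h : β < α), A β h)

theorem seq_add_one (u : Ultrafilter ℕ) (α : Ordinal.{0}) : seq u (α + 1) = trim (seq u α) :=
  Ordinal.limitRecOn_add_one ..

theorem seq_limit (u : Ultrafilter ℕ) {α : Ordinal.{0}} (hα : Order.IsSuccLimit α) :
    seq u α = ⋂ (β) (_ : β < α), seq u β :=
  Ordinal.limitRecOn_limit _ _ _ _ hα

theorem seq_antitone (u : Ultrafilter ℕ) : Antitone (seq u) := by
  intro α β
  induction β using Ordinal.limitRecOn with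
  | zero =>
    intro h
    have : α = 0 := by simpa using h
    rw [this]
  | add_one β ih =>
    intro h
    rcases h.eq_or_lt with rfl | h
    · exact le_rfl
    · rw [seq_add_one]
      exact sdiff_subset.trans (ih (Order.lt_add_one_iff.1 h))
  | limit β hβ _ =>
    intro h
    rcases h.eq_or_lt with rfl | h
    · exact le_rfl
    · rw [seq_limit u hβ]
      exact iInter₂_subset α h

/-- The sequence becomes constant, so that `delta` below is a genuine minimum. -/
theorem exists_seq_eq (u : Ultrafilter ℕ) : ∃ α : Ordinal.{0}, seq u α = seq u (α + 1) := by
  by_contra! h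
  have hs : StrictAnti (seq u) := fun α β hαβ =>
    lt_of_le_of_lt (seq_antitone u (Order.add_one_le_of_lt hαβ))
      (lt_of_le_of_ne (seq_antitone u (Order.le_succ α)) (h α).symm)
  exact not_injective_of_ordinal (seq u) hs.injective

/-- The minimal `δ` with `X_δ = X_{δ+1}`. -/
def delta (u : Ultrafilter ℕ) : Ordinal.{0} := sInf {α | seq u α = seq u (α + 1)}

/-- The space `K = B_u ∪ X_δ`, used below as a subspace of `β(ω × [0,1]²)`. -/
def K (u : Ultrafilter ℕ) : Set (StoneCech SS) := bottom u ∪ seq u (delta u)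

/-- The function `g = f_u ↾ K`. -/
def g (u : Ultrafilter ℕ) : C(K u, ℝ) where
  toFun p := (betaF p : ℝ)
  continuous_toFun := continuous_subtype_val.comp
    ((continuous_stoneCechExtend _).comp continuous_subtype_val)

end ConnectedFSpace

end

/-! In a connected `F`-space a nonconstant `h` has a level `t ≠ 0` whose fiber has interior:
otherwise a function separating `{h < t}` from `{h > t}` would take only the values 0 and 1. On that
interior `h - t • 1` vanishes and `1` does not, so no `h` can be added to `{1}`. If `g` is a
`d`-combination of `{1}`, it is constant wherever a member of a given band is nonzero, and fullness
makes `Omega g` dense.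

For the concrete space, closed subsets of `S_u` are `F`-spaces because `u` is free. The trimming
ends at the largest nowhere constant subset `X_δ` of `S_u`. By Zorn and compactness, `X_δ` meets
every nonempty closed `M ⊆ S_u` whose `betaF`-image has no isolated points (`nonempty_inter_seq`).
With `M` in the top line, `X_δ` leaves `B_u`, so `Omega g` is not dense.

For connectedness, let `F` separate `K` into values 0 and 1. It is constant, say 1, on `B_u`. The
levels of the part of `X_δ` with `F = 0` have no isolated points. Moving down vertical segments
finds all these levels on `{F = 1/2}`, which must then meet `X_δ`: a contradiction. -/

namespace VectorLattice

/-! ### Disjointness and `d`-independence in `C(K)`. -/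

variable {K : Type*} [TopologicalSpace K]

theorem disj_continuousMap_iff {x y : C(K, ℝ)} : Disj x y ↔ ∀ p, x p = 0 ∨ y p = 0 := by
  have key (a b : ℝ) : |a| ⊓ |b| = 0 ↔ a = 0 ∨ b = 0 := by
    constructor
    · intro h
      rcases min_choice |a| |b| with h' | h'
      · exact Or.inl (abs_eq_zero.1 (h'.symm.trans h))
      · exact Or.inr (abs_eq_zero.1 (h'.symm.trans h))
    · rintro (rfl | rfl) <;> simp
  refine DFunLike.ext_iff.trans (forall_congr' fun p => ?_)
  rw [← key]
  simp

/-- The disjoint complement of an element of `C(K, ℝ)`. -/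
def disjointComplement (x : C(K, ℝ)) : Submodule ℝ C(K, ℝ) where
  carrier := {f | ∀ p, x p = 0 ∨ f p = 0}
  zero_mem' _ := Or.inr rfl
  add_mem' {f h} hf hh p := (hf p).elim Or.inl fun h1 =>
    (hh p).elim Or.inl fun h2 => Or.inr (by simp [h1, h2])
  smul_mem' c f hf p := (hf p).elim Or.inl fun h1 => Or.inr (by simp [h1])

theorem isBand_disjointComplement (x : C(K, ℝ)) : IsBand (disjointComplement x) where
  solid f hf h hle p := by
    refine (hf p).imp_right fun h0 => ?_
    have := hle p
    simpa [h0] using this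
  lub_mem s hs a ha p := by
    by_cases hx : x p = 0
    · exact Or.inl hx
    obtain ⟨f, hf⟩ : s.Nonempty := by
      by_contra hne
      have : a p ≤ a p - 1 :=
        ha.2 (show a - 1 ∈ upperBounds s by simp [not_nonempty_iff_eq_empty.1 hne]) p
      linarith
    -- Still an upper bound: nothing is subtracted where `x = 0`, and elsewhere members of `s`
    -- vanish while at most `a` is subtracted. Leastness of `a` then kills `|x| ⊓ a⁺`.
    have hub : a - |x| ⊓ (a ⊔ 0) ∈ upperBounds s := by
      intro f hf q
      have hfa : f q ≤ a q := ha.1 hf q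
      change f q ≤ a q - |x| q ⊓ (a q ⊔ 0)
      rcases hs hf q with hq | hq
      · simp [hq, hfa]
      · have : |x| q ⊓ (a q ⊔ 0) ≤ a q := inf_le_right.trans (sup_le le_rfl (hq ▸ hfa))
        linarith
    have hle : a p ≤ a p - |x p| ⊓ (a p ⊔ 0) := ha.2 hub p
    have h1 : |x p| ⊓ (a p ⊔ 0) ≤ 0 := by linarith
    have h2 : f p ≤ a p := ha.1 hf p
    rw [(hs hf p).resolve_left hx] at h2
    have h3 : a p ⊔ 0 ≤ 0 := (inf_le_iff.1 h1).resolve_left (not_le.2 (abs_pos.2 hx))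
    exact Or.inr (le_antisymm (le_sup_left.trans h3) h2)

theorem exists_continuousMap_eq_one_eq_zero [CompactSpace K] [T2Space K] {U : Set K}
    (hU : IsOpen U) {p : K} (hp : p ∈ U) :
    ∃ f : C(K, ℝ), f p = 1 ∧ ∀ q ∉ U, f q = 0 := by
  obtain ⟨f, h0, h1, -⟩ := exists_continuous_zero_one_of_isClosed hU.isClosed_compl
    (isClosed_singleton (x := p)) (by simpa using hp)
  exact ⟨f, h1 rfl, fun q hq => h0 hq⟩

/-- In a connected `F`-space, every level strictly between two values of a continuous function
has a fiber with nonempty interior. -/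
theorem interior_fiber_nonempty [PreconnectedSpace K] (hK : ConnectedFSpace.IsFSpace K)
    (h : C(K, ℝ)) {p q : K} {t : ℝ} (hp : h p < t) (hq : t < h q) :
    (interior (h ⁻¹' {t})).Nonempty := by
  obtain ⟨k, hk0, hk1⟩ := hK.2 ((ContinuousMap.const K t - h) ⊔ 0)
    ((h - ContinuousMap.const K t) ⊔ 0) fun x => by
      rcases le_total (h x) t with hx | hx
      · exact Or.inr (by simpa using hx)
      · exact Or.inl (by simpa using hx)
  have k0 (x) (hx : h x < t) : k x = 0 := hk0 x (by simpa using hx)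
  have k1 (x) (hx : t < h x) : k x = 1 := hk1 x (by simpa using hx)
  by_contra hne
  have hd := interior_eq_empty_iff_dense_compl.1 (not_nonempty_iff_eq_empty.1 hne)
  have hcl : IsClosed (k ⁻¹' {0, 1}) := (Set.toFinite _).isClosed.preimage k.continuous
  have hall (x : K) : k x = 0 ∨ k x = 1 :=
    (hcl.closure_subset_iff.2 (fun y hy => (lt_or_gt_of_ne hy).imp (k0 y) (k1 y))) (hd x)
  obtain ⟨x, hx⟩ := mem_range_of_exists_le_of_exists_ge k.continuous (c := 1 / 2)
    ⟨p, by rw [k0 p hp]; norm_num⟩ ⟨q, by rw [k1 q hq]; norm_num⟩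
  rcases hall x with h' | h' <;> rw [h'] at hx <;> norm_num at hx

theorem isDIndependent_singleton_one [Nonempty K] : IsDIndependent ({1} : Set C(K, ℝ)) where
  ne_zero := by simp
  disj B _ F hF c hc h d hd b hb := by
    obtain rfl : d = 1 := hF hd
    obtain rfl : F = {1} := Finset.eq_singleton_iff_unique_mem.2 ⟨hd, fun x hx => hF hx⟩
    have h' := disj_continuousMap_iff.1 (h b hb)
    refine disj_continuousMap_iff.2 fun p => (h' p).imp_left fun h0 => ?_
    simp [hc 1 hd] at h0

theorem maximal_isDIndependent_singleton_one [CompactSpace K] [T2Space K] [ConnectedSpace K]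
    (hK : ConnectedFSpace.IsFSpace K) : Maximal IsDIndependent ({1} : Set C(K, ℝ)) := by
  classical
  refine ⟨isDIndependent_singleton_one, fun D hD h1 h hh => ?_⟩
  by_contra hne
  replace hne : h ≠ 1 := hne
  -- `t ≠ 0` is needed because `-t` will be the coefficient of `1`, and coefficients must be
  -- nonzero.
  obtain ⟨t, ht0, p, hp⟩ : ∃ t : ℝ, t ≠ 0 ∧ (interior (h ⁻¹' {t})).Nonempty := by
    by_cases hc : ∃ p q, h p < h q
    · obtain ⟨p, q, hpq⟩ := hc
      obtain ⟨s, hps, hsq⟩ := exists_between hpq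
      by_cases hs : s = 0
      · obtain ⟨r, hsr, hrq⟩ := exists_between hsq
        exact ⟨r, by rw [hs] at hsr; exact hsr.ne',
          interior_fiber_nonempty hK h (hps.trans hsr) hrq⟩
      · exact ⟨s, hs, interior_fiber_nonempty hK h hps hsq⟩
    · push Not at hc
      obtain ⟨p, hp⟩ : ∃ p, h p ≠ 0 := by
        by_contra! h0
        exact hD.ne_zero h hh (ContinuousMap.ext h0)
      refine ⟨h p, hp, p, ?_⟩
      rw [show h ⁻¹' {h p} = univ from eq_univ_of_forall fun q => le_antisymm (hc p q) (hc q p)]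
      simp
  obtain ⟨f, hf1, hf0⟩ := exists_continuousMap_eq_one_eq_zero isOpen_interior hp
  have hsum : ∑ d ∈ ({1, h} : Finset C(K, ℝ)), (if d = h then (1 : ℝ) else -t) • d
      = h - ContinuousMap.const K t := by
    rw [Finset.sum_pair hne.symm]
    ext q
    simp [hne.symm]
    ring
  -- The bump `f`, supported in the interior of the fiber, lies in this band, so independence would
  -- force `1 ⊥ f`.
  have hd := hD.disj _ (isBand_disjointComplement (h - ContinuousMap.const K t)) {1, h}
    (by simp [insert_subset_iff, hh, h1 rfl]) (fun d => if d = h then 1 else -t)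
    (fun d _ => by split_ifs <;> simp [ht0])
    (by rw [hsum]; exact fun b hb => disj_continuousMap_iff.2 hb) 1 (by simp) f
    (fun q => by
      by_cases hq : q ∈ interior (h ⁻¹' {t})
      · have hq' : q ∈ h ⁻¹' {t} := interior_subset hq
        exact Or.inl (by simpa [sub_eq_zero] using hq')
      · exact Or.inr (hf0 q hq))
  rcases disj_continuousMap_iff.1 hd p with h' | h'
  · simp at h'
  · simp [hf1] at h'

theorem dense_omega_of_isDCombination [CompactSpace K] [T2Space K] {g : C(K, ℝ)}
    (hg : IsDCombination ({1} : Set C(K, ℝ)) g) : Dense (ConnectedFSpace.Omega g) := by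
  obtain ⟨𝓑, h𝓑, y, hy⟩ := hg
  by_contra hd
  have : (closure (ConnectedFSpace.Omega g))ᶜ.Nonempty :=
    nonempty_compl.2 fun h => hd (dense_iff_closure_eq.2 h)
  obtain ⟨p, hp⟩ := this
  obtain ⟨f, hf1, hf0⟩ := exists_continuousMap_eq_one_eq_zero isClosed_closure.isOpen_compl hp
  suffices f = 0 by simp [this] at hf1
  refine h𝓑.full f fun B hB b hb => disj_continuousMap_iff.2 fun q => ?_
  by_contra! hq
  obtain ⟨hspan, hdisj⟩ := hy B hB
  obtain ⟨c, hc⟩ := Submodule.mem_span_singleton.1 hspan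
  refine hq.1 (hf0 q fun hq' => hq' (subset_closure ?_))
  refine mem_iUnion.2 ⟨c, mem_interior.2 ⟨{r | b r ≠ 0}, fun r hr => ?_,
    isOpen_ne_fun b.continuous continuous_const, hq.2⟩⟩
  have := (disj_continuousMap_iff.1 (hdisj b hb) r).resolve_right hr
  rw [← hc] at this
  simpa [sub_eq_zero] using this

theorem singleton_one_of_not_dense_omega [CompactSpace K] [T2Space K] [ConnectedSpace K]
    (hK : ConnectedFSpace.IsFSpace K) (g : C(K, ℝ)) (hg : ¬ Dense (ConnectedFSpace.Omega g)) :
    Maximal IsDIndependent ({1} : Set C(K, ℝ)) ∧ ¬ IsDCombination ({1} : Set C(K, ℝ)) g ∧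
      ¬ IsDBasis ({1} : Set C(K, ℝ)) :=
  ⟨maximal_isDIndependent_singleton_one hK, fun h => hg (dense_omega_of_isDCombination h),
    fun h => hg (dense_omega_of_isDCombination (h.2 g))⟩

end VectorLattice

/-! ### The trimming sequence and nowhere constant sets. -/

namespace ConnectedFSpace

open Filter

theorem continuous_betaPi : Continuous betaPi := continuous_stoneCechExtend _

theorem continuous_betaF : Continuous betaF := continuous_stoneCechExtend _

@[simp]
theorem betaPi_stoneCechUnit (z : SS) : betaPi (stoneCechUnit z) = pure z.1 :=
  stoneCechExtend_stoneCechUnit _ z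

@[simp]
theorem betaF_stoneCechUnit (z : SS) : betaF (stoneCechUnit z) = z.2.1 :=
  stoneCechExtend_stoneCechUnit _ z

theorem isClosed_fiber (u : Ultrafilter ℕ) : IsClosed (fiber u) :=
  isClosed_singleton.preimage continuous_betaPi

theorem isClosed_bottom (u : Ultrafilter ℕ) : IsClosed (bottom u) :=
  (isClosed_fiber u).inter isClosed_closure

/-- No nonempty relatively open subset of `A` is contained in a fiber of `betaF`. -/
def NowhereConstant (A : Set (StoneCech SS)) : Prop :=
  ∀ V, IsOpen V → ∀ t, A ∩ V ⊆ betaF ⁻¹' {t} → A ∩ V = ∅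

theorem mem_trim {A : Set (StoneCech SS)} {p : StoneCech SS} :
    p ∈ trim A ↔ p ∈ A ∧ ∀ V, IsOpen V → p ∈ V → ∀ t, ¬ A ∩ V ⊆ betaF ⁻¹' {t} := by
  refine and_congr_right fun hp => ?_
  constructor
  · intro h V hV hpV t hsub
    refine h (mem_iUnion.2 ⟨t, ⟨p, hp⟩, mem_interior.2 ⟨((↑) : A → StoneCech SS) ⁻¹' V,
      fun q hq => hsub ⟨q.2, hq⟩, hV.preimage continuous_subtype_val, hpV⟩, rfl⟩)
  · intro h hmem
    obtain ⟨t, q, hq, rfl⟩ := mem_iUnion.1 hmem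
    obtain ⟨W, hW, hWo, hqW⟩ := mem_interior.1 hq
    obtain ⟨V, hV, rfl⟩ := isOpen_induced_iff.1 hWo
    exact h V hV hqW t fun r hr => hW (show (⟨r, hr.1⟩ : A) ∈ _ from hr.2)

theorem isClosed_trim {A : Set (StoneCech SS)} (hA : IsClosed A) : IsClosed (trim A) := by
  have : trim A = A \ ⋃ V ∈ {V | IsOpen V ∧ ∃ t, A ∩ V ⊆ betaF ⁻¹' {t}}, V := by
    ext p
    rw [mem_trim]
    simp only [Set.mem_sdiff, mem_iUnion, mem_ofPred_eq, not_exists]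
    exact and_congr_right fun _ =>
      ⟨fun h V hV hp => hV.2.elim (h V hV.1 hp), fun h V hV hp t ht => h V ⟨hV, t, ht⟩ hp⟩
  rw [this]
  exact hA.sdiff (isOpen_biUnion fun V hV => hV.1)

theorem isClosed_seq (u : Ultrafilter ℕ) (α : Ordinal.{0}) : IsClosed (seq u α) := by
  induction α using Ordinal.limitRecOn with
  | zero => rw [seq, Ordinal.limitRecOn_zero]; exact isClosed_fiber u
  | add_one α ih => rw [seq_add_one]; exact isClosed_trim ih
  | limit α hα ih => rw [seq_limit u hα]; exact isClosed_biInter ih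

/-- An open set on which `betaF` is constant along `X_α ⊇ A` misses `A`, so trimming never removes a
point of `A`. -/
theorem NowhereConstant.subset_seq {u : Ultrafilter ℕ} {A : Set (StoneCech SS)}
    (hA : NowhereConstant A) (hAu : A ⊆ fiber u) (α : Ordinal.{0}) : A ⊆ seq u α := by
  induction α using Ordinal.limitRecOn with
  | zero => rwa [seq, Ordinal.limitRecOn_zero]
  | add_one α ih =>
    rw [seq_add_one]
    refine fun p hp => mem_trim.2 ⟨ih hp, fun V hV hpV t hsub => ?_⟩
    have : p ∈ A ∩ V := ⟨hp, hpV⟩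
    rw [hA V hV t ((inter_subset_inter_left V ih).trans hsub)] at this
    exact this
  | limit α hα ih => rw [seq_limit u hα]; exact subset_iInter₂ ih

theorem seq_subset_fiber (u : Ultrafilter ℕ) (α : Ordinal.{0}) : seq u α ⊆ fiber u := by
  have := seq_antitone u (zero_le (a := α))
  rwa [seq, seq, Ordinal.limitRecOn_zero] at this

theorem nowhereConstant_seq_delta (u : Ultrafilter ℕ) : NowhereConstant (seq u (delta u)) := by
  intro V hV t hsub
  by_contra hne
  obtain ⟨p, hp, hpV⟩ := nonempty_iff_ne_empty.2 hne
  have h : seq u (delta u) = seq u (delta u + 1) := csInf_mem (exists_seq_eq u)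
  have hp' := hp
  rw [h, seq_add_one] at hp'
  exact (mem_trim.1 hp').2 V hV hpV t hsub

/-- A closed set whose image under `betaF` has no isolated points contains a nowhere constant
set with the same image. -/
theorem exists_nowhereConstant_subset {M : Set (StoneCech SS)} (hM : IsClosed M)
    (hperf : ∀ t ∈ betaF '' M, t ∈ closure (betaF '' M \ {t})) :
    ∃ E ⊆ M, NowhereConstant E ∧ betaF '' M ⊆ betaF '' E := by
  -- `E` is a minimal closed subset with full image; compactness of the fibers handles chains.
  obtain ⟨E, hE⟩ := zorn_superset {E | IsClosed E ∧ E ⊆ M ∧ betaF '' M ⊆ betaF '' E} <| by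
    intro c hc hchain
    rcases c.eq_empty_or_nonempty with rfl | hne
    · exact ⟨M, ⟨hM, Subset.rfl, Subset.rfl⟩, by simp⟩
    refine ⟨⋂₀ c, ⟨isClosed_sInter fun E hE => (hc hE).1,
      (sInter_subset_of_mem hne.some_mem).trans (hc hne.some_mem).2.1, fun t ht => ?_⟩,
      fun E hE => sInter_subset_of_mem hE⟩
    have : Nonempty c := hne.to_subtype
    have hcl (E : c) : IsClosed (E.1 ∩ betaF ⁻¹' {t}) :=
      (hc E.2).1.inter (isClosed_singleton.preimage continuous_betaF)
    obtain ⟨p, hp⟩ := IsCompact.nonempty_iInter_of_directed_nonempty_isCompact_isClosed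
      (fun E : c => E.1 ∩ betaF ⁻¹' {t})
      (fun E E' => by
        rcases hchain.total E.2 E'.2 with h | h
        · exact ⟨E, Subset.rfl, inter_subset_inter_left _ h⟩
        · exact ⟨E', inter_subset_inter_left _ h, Subset.rfl⟩)
      (fun E => (hc E.2).2.2 ht) (fun E => (hcl E).isCompact) hcl
    exact ⟨p, mem_sInter.2 fun E hE => (mem_iInter.1 hp ⟨E, hE⟩).1,
      (mem_iInter.1 hp ⟨_, hne.some_mem⟩).2⟩
  obtain ⟨hEc, hEM, hEim⟩ := hE.prop
  refine ⟨E, hEM, fun V hV t hsub => ?_, hEim⟩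
  by_contra hne
  obtain ⟨p, hp, hpV⟩ := nonempty_iff_ne_empty.2 hne
  have hpt : betaF p = t := hsub ⟨hp, hpV⟩
  have hcl : IsClosed (E \ V) := hEc.sdiff hV
  -- Deleting `V` can lose only the level `t`, and `t` is a limit of the other levels, so the
  -- compact image of `E \ V` regains it, against minimality.
  have hdiff : betaF '' M \ {t} ⊆ betaF '' (E \ V) := by
    rintro s ⟨hs, hst⟩
    obtain ⟨q, hq, rfl⟩ := hEim hs
    exact ⟨q, ⟨hq, fun hqV => hst (hsub ⟨hq, hqV⟩)⟩, rfl⟩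
  have hcl' := closure_minimal hdiff (hcl.isCompact.image continuous_betaF).isClosed
  refine (hE.le_of_le ⟨hcl, sdiff_subset.trans hEM, fun s hs => ?_⟩ sdiff_subset hp).2 hpV
  exact hcl' (by
    by_cases hst : s = t
    · rw [hst]; exact hperf t (hst ▸ hs)
    · exact subset_closure ⟨hs, hst⟩)

theorem nonempty_inter_seq {u : Ultrafilter ℕ} {M : Set (StoneCech SS)} (hM : IsClosed M)
    (hMu : M ⊆ fiber u) (hne : M.Nonempty)
    (hperf : ∀ t ∈ betaF '' M, t ∈ closure (betaF '' M \ {t})) (α : Ordinal.{0}) :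
    (M ∩ seq u α).Nonempty := by
  obtain ⟨E, hEM, hE, him⟩ := exists_nowhereConstant_subset hM hperf
  obtain ⟨q, hq, -⟩ := him (mem_image_of_mem _ hne.some_mem)
  exact ⟨q, hEM hq, hE.subset_seq (hEM.trans hMu) α hq⟩

/-! ### Passing from the squares `{n} × [0,1]²` to `S_u`. -/

/-- The compact image of `Q` contains `pure n` for `u`-many `n`, and these converge to `u`. -/
theorem exists_mem_betaPi_eq {u : Ultrafilter ℕ} {Q : Set (StoneCech SS)} (hQ : IsClosed Q)
    {A : Set ℕ} (hA : A ∈ u) (h : ∀ n ∈ A, ∃ z : SS, stoneCechUnit z ∈ Q ∧ z.1 = n) :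
    ∃ q ∈ Q, betaPi q = u := by
  refine (hQ.isCompact.image continuous_betaPi).isClosed.mem_of_tendsto
    (Ultrafilter.tendsto_pure_self u) (mem_of_superset hA fun n hn => ?_)
  obtain ⟨z, hz, rfl⟩ := h n hn
  exact ⟨_, hz, betaPi_stoneCechUnit z⟩

/-- Points of the closure of `D ⊆ ω × [0,1]²` satisfy every closed condition that holds at the
points of `D` near them. -/
theorem mem_of_forall_near {Y : Type*} [TopologicalSpace Y] {Φ : StoneCech SS → Y}
    (hΦ : Continuous Φ) {C : Set Y} (hC : IsClosed C) {D : Set SS} {p : StoneCech SS}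
    (hp : p ∈ closure (stoneCechUnit '' D)) {V : Set (StoneCech SS)} (hV : IsOpen V)
    (hpV : p ∈ V) (h : ∀ z ∈ D, stoneCechUnit z ∈ V → Φ (stoneCechUnit z) ∈ C) : Φ p ∈ C := by
  have hcl : p ∈ closure (V ∩ stoneCechUnit '' D) := hV.inter_closure ⟨hpV, hp⟩
  refine closure_minimal ?_ (hC.preimage hΦ) hcl
  rintro _ ⟨hzV, z, hz, rfl⟩
  exact h z hz hzV

theorem mem_closure_image_univ (p : StoneCech SS) :
    p ∈ closure ((stoneCechUnit : SS → StoneCech SS) '' univ) := by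
  rw [image_univ]
  exact denseRange_stoneCechUnit p

theorem isOpen_setOf_mem_betaPi (A : Set ℕ) : IsOpen {p | A ∈ betaPi p} :=
  (ultrafilter_isOpen_basic A).preimage continuous_betaPi

theorem setOf_exists_mem {u : Ultrafilter ℕ} {p : StoneCech SS} (hp : p ∈ bottom u)
    {V : Set (StoneCech SS)} (hV : IsOpen V) (hpV : p ∈ V) :
    {n | ∃ x, (stoneCechUnit ((n, x, 0) : SS)) ∈ V} ∈ u := by
  by_contra hn
  have hn' := Ultrafilter.compl_mem_iff_notMem.2 hn
  rw [← show betaPi p = u from hp.1] at hn'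
  refine mem_of_forall_near (Φ := id) continuous_id isClosed_empty hp.2
    (hV.inter (isOpen_setOf_mem_betaPi _)) ⟨hpV, hn'⟩ ?_
  rintro ⟨n, x, y⟩ rfl ⟨h1, h2⟩
  simp only [mem_ofPred_eq, betaPi_stoneCechUnit, Ultrafilter.mem_pure] at h2
  exact h2 ⟨x, h1⟩

/-- Extend `|a| - |b|` to `F` on `β(ω × [0,1]²)` and clamp `1/2 - n * F` to `[0,1]`. Since `u` is
free, `n` is arbitrarily large near `S_u`, so the extension is 0 where `F > 0` and 1 where `F < 0`.
-/
theorem isFSpace_of_isClosed {u : Ultrafilter ℕ} (hu : u ∉ range (pure : ℕ → Ultrafilter ℕ))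
    {Z : Set (StoneCech SS)} (hZ : IsClosed Z) (hZu : Z ⊆ fiber u) : IsFSpace Z := by
  have : CompactSpace Z := isCompact_iff_compactSpace.1 hZ.isCompact
  refine ⟨inferInstance, fun a b hab => ?_⟩
  obtain ⟨F, hF⟩ := ContinuousMap.exists_restrict_eq hZ (|a| - |b|)
  have hF' (p : Z) : F p = |a p| - |b p| := by
    have := DFunLike.congr_fun hF p
    simpa using this
  have hfree (N : ℕ) : {n | N ≤ n} ∈ u := by
    rcases u.le_cofinite_or_eq_pure with h | ⟨n, hn⟩
    · exact h (by rw [Nat.cofinite_eq_atTop]; exact mem_atTop N)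
    · exact absurd ⟨n, hn.symm⟩ hu
  have hHc : Continuous fun z : SS =>
      projIcc (0 : ℝ) 1 zero_le_one (1 / 2 - (z.1 : ℝ) * F (stoneCechUnit z)) :=
    continuous_projIcc.comp (continuous_const.sub
      ((continuous_of_discreteTopology.comp continuous_fst).mul
        (F.continuous.comp continuous_stoneCechUnit)))
  set H := stoneCechExtend hHc
  have hH : Continuous H := continuous_stoneCechExtend _
  have hHz (z : SS) : H (stoneCechUnit z) = _ := stoneCechExtend_stoneCechUnit hHc z
  refine ⟨⟨fun p => (H p : ℝ), continuous_subtype_val.comp (hH.comp continuous_subtype_val)⟩,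
    fun p hp => ?_, fun p hp => ?_⟩
  · have hpos : 0 < F p := by
      rw [hF', (hab p).resolve_left hp]; simpa using hp
    obtain ⟨N, hN⟩ := exists_nat_gt ((1 / 2) / (F p / 2))
    rw [div_lt_iff₀ (by positivity)] at hN
    have : H p ∈ ({0} : Set unitInterval) := mem_of_forall_near hH isClosed_singleton
      (mem_closure_image_univ _) ((isOpen_lt continuous_const F.continuous).inter
        (isOpen_setOf_mem_betaPi _))
      ⟨half_lt_self hpos, show {n | N ≤ n} ∈ betaPi p by rw [hZu p.2]; exact hfree N⟩
      fun z _ hz => by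
        have h1 : (F p) / 2 < F (stoneCechUnit z) := hz.1
        have h2 : N ≤ z.1 := by simpa using hz.2
        have h3 : (N : ℝ) ≤ z.1 := by exact_mod_cast h2
        rw [hHz]
        refine projIcc_of_le_left _ ?_
        nlinarith [mul_le_mul h3 h1.le (by positivity) (by positivity)]
    simp [mem_singleton_iff.1 this]
  · have hneg : 0 < - F p := by
      rw [hF', (hab p).resolve_right hp]; simpa using hp
    obtain ⟨N, hN⟩ := exists_nat_gt ((1 / 2) / (-F p / 2))
    rw [div_lt_iff₀ (by positivity)] at hN
    have : H p ∈ ({1} : Set unitInterval) := mem_of_forall_near hH isClosed_singleton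
      (mem_closure_image_univ _) ((isOpen_lt continuous_const F.continuous.neg).inter
        (isOpen_setOf_mem_betaPi _))
      ⟨half_lt_self hneg, show {n | N ≤ n} ∈ betaPi p by rw [hZu p.2]; exact hfree N⟩
      fun z _ hz => by
        have h1 : (-F p) / 2 < -F (stoneCechUnit z) := hz.1
        have h2 : N ≤ z.1 := by simpa using hz.2
        have h3 : (N : ℝ) ≤ z.1 := by exact_mod_cast h2
        rw [hHz]
        refine projIcc_of_right_le _ ?_
        nlinarith [mul_le_mul h3 h1.le (by positivity) (by positivity)]
    simp [mem_singleton_iff.1 this]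

/-! ### The space `K`: `Omega g` is not dense, and `K` is connected. -/

theorem isClosed_K (u : Ultrafilter ℕ) : IsClosed (K u) :=
  (isClosed_bottom u).union (isClosed_seq u _)

theorem K_subset_fiber (u : Ultrafilter ℕ) : K u ⊆ fiber u :=
  union_subset inter_subset_left (seq_subset_fiber u _)

theorem exists_mem_seq_notMem_bottom (u : Ultrafilter ℕ) (α : Ordinal.{0}) :
    ∃ p ∈ seq u α, p ∉ bottom u := by
  have hYc : Continuous fun z : SS => z.2.2 := continuous_snd.comp continuous_snd
  set Y := stoneCechExtend hYc
  have hY : Continuous Y := continuous_stoneCechExtend _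
  have hYz (z : SS) : Y (stoneCechUnit z) = z.2.2 := stoneCechExtend_stoneCechUnit hYc z
  have hM : IsClosed (fiber u ∩ Y ⁻¹' {1}) :=
    (isClosed_fiber u).inter (isClosed_singleton.preimage hY)
  have him : betaF '' (fiber u ∩ Y ⁻¹' {1}) = univ := by
    refine eq_univ_of_forall fun t => ?_
    obtain ⟨q, hq, hqu⟩ := exists_mem_betaPi_eq (u := u) (A := univ)
      ((isClosed_singleton.preimage hY).inter (isClosed_singleton.preimage continuous_betaF) :
        IsClosed (Y ⁻¹' {1} ∩ betaF ⁻¹' {t})) univ_mem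
      fun n _ => ⟨(n, t, 1), ⟨hYz _, betaF_stoneCechUnit _⟩, rfl⟩
    exact ⟨q, ⟨hqu, hq.1⟩, hq.2⟩
  obtain ⟨p, hp, hps⟩ := nonempty_inter_seq hM inter_subset_left
    (image_nonempty.1 (him ▸ univ_nonempty)) (fun t _ => by
      rw [him, ← compl_eq_univ_sdiff, closure_compl_singleton]; trivial) α
  refine ⟨p, hps, fun hb => ?_⟩
  have h0 : Y p = 0 := mem_of_forall_near hY (isClosed_singleton (x := (0 : unitInterval))) hb.2
    isOpen_univ (mem_univ p) fun z hz _ => (hYz z).trans hz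
  exact zero_ne_one (h0.symm.trans hp.2)

theorem not_dense_omega_g (u : Ultrafilter ℕ) : ¬ Dense (Omega (g u)) := by
  intro hd
  obtain ⟨p, hp, hpb⟩ := exists_mem_seq_notMem_bottom u (delta u)
  obtain ⟨q, hqb, hq⟩ := hd.inter_open_nonempty (((↑) : K u → StoneCech SS) ⁻¹' (bottom u)ᶜ)
    ((isClosed_bottom u).isOpen_compl.preimage continuous_subtype_val) ⟨⟨p, Or.inr hp⟩, hpb⟩
  obtain ⟨t, ht⟩ := mem_iUnion.1 hq
  obtain ⟨W, hW, hWo, hqW⟩ := mem_interior.1 ht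
  obtain ⟨V, hV, rfl⟩ := isOpen_induced_iff.1 hWo
  have hgt (r : K u) (hr : r.1 ∈ V) : (betaF r : ℝ) = t := hW hr
  have := nowhereConstant_seq_delta u (V ∩ (bottom u)ᶜ)
    (hV.inter (isClosed_bottom u).isOpen_compl) (betaF q) fun r hr => Subtype.ext
      ((hgt ⟨r, Or.inr hr.1⟩ hr.2.1).trans (hgt q hqW).symm)
  exact this.subset ⟨q.2.resolve_left hqb, hqW, hqb⟩

/-- The intermediate value theorem on the bottom edge of the `n`-th square, for `u`-many `n`. -/
theorem exists_mem_bottom_eq_half {u : Ultrafilter ℕ} (F : C(StoneCech SS, ℝ))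
    {p q : StoneCech SS} (hp : p ∈ bottom u) (hq : q ∈ bottom u) (hFp : F p < 1 / 2)
    (hFq : 1 / 2 < F q) : ∃ r ∈ bottom u, F r = 1 / 2 := by
  obtain ⟨r, hr, hru⟩ := exists_mem_betaPi_eq
    ((isClosed_closure (s := stoneCechUnit '' {p : SS | p.2.2 = 0})).inter
      ((isClosed_singleton (x := (1 / 2 : ℝ))).preimage F.continuous))
    (inter_mem (setOf_exists_mem hp (isOpen_lt F.continuous continuous_const) hFp)
      (setOf_exists_mem hq (isOpen_lt continuous_const F.continuous) hFq))
    fun n ⟨⟨x, hx⟩, ⟨x', hx'⟩⟩ => by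
      obtain ⟨s, hs⟩ := mem_range_of_exists_le_of_exists_ge (c := (1 / 2 : ℝ))
        (f := fun s : unitInterval => F (stoneCechUnit ((n, s, 0) : SS)))
        (F.continuous.comp (continuous_stoneCechUnit.comp (by fun_prop)))
        ⟨x, le_of_lt hx⟩ ⟨x', le_of_lt hx'⟩
      exact ⟨(n, s, 0), ⟨subset_closure ⟨_, rfl, rfl⟩, hs⟩, rfl⟩
  exact ⟨r, ⟨hru, hr.1⟩, hr.2⟩

/-- If `F = 1` on the bottom line, then levels of `betaF` at points of the fiber with `F < 1/2`
are attained on the fiber at points with `F = 1/2`. -/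
theorem exists_eq_half_betaF_eq {u : Ultrafilter ℕ} (F : C(StoneCech SS, ℝ))
    (hb : ∀ p ∈ bottom u, 1 / 2 < F p) {p : StoneCech SS} (hp : p ∈ fiber u)
    (hFp : F p < 1 / 2) : ∃ q ∈ fiber u, F q = 1 / 2 ∧ betaF q = betaF p := by
  -- Otherwise bad bottom points accumulate at a point of `B_u` with `F ≤ 1/2`.
  have hA : {n | ∀ x, 1 / 2 < F (stoneCechUnit ((n, x, 0) : SS))} ∈ u := by
    by_contra hn
    obtain ⟨r, hr, hru⟩ := exists_mem_betaPi_eq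
      ((isClosed_closure (s := stoneCechUnit '' {p : SS | p.2.2 = 0})).inter 
        (isClosed_le F.continuous (continuous_const (y := (1 / 2 : ℝ)))))
      (Ultrafilter.compl_mem_iff_notMem.2 hn) fun n hn => by
        simp only [mem_compl_iff, mem_ofPred_eq, not_forall, not_lt] at hn
        obtain ⟨x, hx⟩ := hn
        exact ⟨(n, x, 0), ⟨subset_closure ⟨_, (rfl : (0 : unitInterval) = 0), rfl⟩, hx⟩, rfl⟩
    exact (hb r ⟨hru, hr.1⟩).not_ge hr.2
  -- As this image is closed, it suffices to treat points `(n, x, y)` near `p`, using the vertical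
  -- segment down to `(n, x, 0)`.
  have hQ : IsClosed ((fun q => (betaPi q, betaF q)) '' (F ⁻¹' {1 / 2})) :=
    ((isClosed_singleton.preimage F.continuous).isCompact.image
      (continuous_betaPi.prodMk continuous_betaF)).isClosed
  obtain ⟨q, hq, hqp⟩ := mem_of_forall_near (continuous_betaPi.prodMk continuous_betaF) hQ
    (mem_closure_image_univ p) ((isOpen_lt F.continuous continuous_const).inter
      (isOpen_setOf_mem_betaPi _)) ⟨hFp, show _ ∈ betaPi p by rw [hp]; exact hA⟩ <| by
    rintro ⟨n, x, y⟩ - ⟨h1, h2⟩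
    have h2' : ∀ x, 1 / 2 < F (stoneCechUnit ((n, x, 0) : SS)) := by simpa using h2
    obtain ⟨s, hs⟩ := mem_range_of_exists_le_of_exists_ge (c := (1 / 2 : ℝ))
      (f := fun s : unitInterval => F (stoneCechUnit ((n, x, s) : SS)))
      (F.continuous.comp (continuous_stoneCechUnit.comp (by fun_prop)))
      ⟨y, le_of_lt h1⟩ ⟨0, (h2' x).le⟩
    exact ⟨stoneCechUnit (n, x, s), hs, by simp⟩
  obtain ⟨h1, h2⟩ := Prod.ext_iff.1 hqp
  exact ⟨q, h1.trans hp, hq, h2⟩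

theorem eq_one_of_eq_one_on_bottom {u : Ultrafilter ℕ} (F : C(StoneCech SS, ℝ))
    (hF : ∀ p ∈ K u, F p = 0 ∨ F p = 1) (hb : ∀ p ∈ bottom u, F p = 1) :
    ∀ p ∈ K u, F p = 1 := by
  intro p hp
  refine (hF p hp).resolve_left fun hp0 => ?_
  have hpX : p ∈ seq u (delta u) := hp.resolve_left fun h => by
    rw [hb p h] at hp0; exact one_ne_zero hp0
  set D := seq u (delta u) ∩ F ⁻¹' {0}
  have hD : IsClosed (betaF '' D) :=
    (((isClosed_seq u _).inter (isClosed_singleton.preimage F.continuous)).isCompact.image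
      continuous_betaF).isClosed
  set M := fiber u ∩ F ⁻¹' {1 / 2} ∩ betaF ⁻¹' (betaF '' D)
  have hM : IsClosed M := ((isClosed_fiber u).inter
    (isClosed_singleton.preimage F.continuous)).inter (hD.preimage continuous_betaF)
  have him : betaF '' M = betaF '' D := by
    refine Subset.antisymm (image_subset_iff.2 fun q hq => hq.2) ?_
    rintro _ ⟨q, hq, rfl⟩
    have hq0 : F q = 0 := hq.2
    obtain ⟨r, hr, hr2, hrq⟩ := exists_eq_half_betaF_eq F
      (fun p hp => by rw [hb p hp]; norm_num) (seq_subset_fiber u _ hq.1)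
      (by rw [hq0]; norm_num)
    exact ⟨r, ⟨⟨hr, hr2⟩, ⟨q, hq, hrq.symm⟩⟩, hrq⟩
  -- `D` is relatively open in `X_δ`, cut out by `F < 1/2`; an isolated level would give a nonempty
  -- open piece of `X_δ` on which `betaF` is constant.
  have hperf : ∀ t ∈ betaF '' D, t ∈ closure (betaF '' D \ {t}) := by
    rintro _ ⟨q, hq, rfl⟩
    by_contra hn
    have hq0 : F q = 0 := hq.2
    refine (nowhereConstant_seq_delta u
      ({r | F r < 1 / 2} ∩ betaF ⁻¹' (closure (betaF '' D \ {betaF q}))ᶜ)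
      ((isOpen_lt F.continuous continuous_const).inter
        (isClosed_closure.isOpen_compl.preimage continuous_betaF)) (betaF q) ?_).subset
      ⟨hq.1, by rw [mem_ofPred_eq, hq0]; norm_num, hn⟩
    rintro r ⟨hr, hr2, hrc⟩
    by_contra hne
    have hr0 : F r = 0 := (hF r (Or.inr hr)).resolve_right fun h => by
      rw [mem_ofPred_eq, h] at hr2; norm_num at hr2
    exact hrc (subset_closure ⟨mem_image_of_mem _ ⟨hr, hr0⟩, hne⟩)
  have hne : (betaF '' M).Nonempty := him ▸ ⟨betaF p, p, ⟨hpX, hp0⟩, rfl⟩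
  obtain ⟨r, hrM, hrX⟩ := nonempty_inter_seq hM (fun q hq => hq.1.1) (image_nonempty.1 hne)
    (him ▸ hperf) (delta u)
  have hr : F r = 1 / 2 := hrM.1.2
  rcases hF r (Or.inr hrX) with h | h <;> rw [h] at hr <;> norm_num at hr

theorem isConnected_K (u : Ultrafilter ℕ) : IsConnected (K u) := by
  obtain ⟨p, hp, -⟩ := exists_mem_seq_notMem_bottom u (delta u)
  refine ⟨⟨p, Or.inr hp⟩, (isPreconnected_iff_subset_of_fully_disjoint_closed (isClosed_K u)).2
    fun C D hC hD hK hCD => ?_⟩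
  obtain ⟨F, h0, h1, -⟩ := exists_continuous_zero_one_of_isClosed hC hD hCD
  have hF : ∀ p ∈ K u, F p = 0 ∨ F p = 1 := fun p hp =>
    (hK hp).imp (fun h => h0 h) (fun h => h1 h)
  by_cases hb : ∀ p ∈ bottom u, F p = 1
  · refine Or.inr fun p hp => (hK hp).resolve_left fun h => ?_
    exact zero_ne_one ((h0 h).symm.trans (eq_one_of_eq_one_on_bottom F hF hb p hp))
  · push Not at hb
    obtain ⟨q, hq, hq1⟩ := hb
    have hq0 : F q = 0 := (hF q (Or.inl hq)).resolve_right hq1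
    -- `F` cannot take both values on `B_u` without taking `1/2`; the case `F = 0` reduces to the
    -- other one through `1 - F`.
    have hb' : ∀ p ∈ bottom u, F p = 0 := fun p hp =>
      (hF p (Or.inl hp)).resolve_right fun hp1 => by
        obtain ⟨r, hr, hr2⟩ := exists_mem_bottom_eq_half F hq hp (by rw [hq0]; norm_num)
          (by rw [hp1]; norm_num)
        rcases hF r (Or.inl hr) with h | h <;> rw [h] at hr2 <;> norm_num at hr2
    refine Or.inl fun p hp => (hK hp).resolve_right fun h => ?_
    have := eq_one_of_eq_one_on_bottom (1 - F)
      (fun p hp => (hF p hp).symm.imp (fun h => by simp [h]) (fun h => by simp [h]))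
      (fun p hp => by simp [hb' p hp]) p hp
    have hp1 : F p = 1 := h1 h
    simp [hp1] at this

end ConnectedFSpace

/-! ### Assembly, with `Filter.hyperfilter ℕ` as the free ultrafilter of the counterexample. -/

theorem mainTheorem2 :
    -- any compact connected `F`-space with a function whose `Ω` is not dense
    (∀ (K : Type*) [TopologicalSpace K] [CompactSpace K] [T2Space K] [ConnectedSpace K],
      ConnectedFSpace.IsFSpace K → ∀ g : C(K, ℝ), ¬ Dense (ConnectedFSpace.Omega g) →
        Maximal VectorLattice.IsDIndependent ({1} : Set C(K, ℝ)) ∧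
        ¬ VectorLattice.IsDCombination ({1} : Set C(K, ℝ)) g ∧
        ¬ VectorLattice.IsDBasis ({1} : Set C(K, ℝ))) ∧
    -- the concrete space `K` and function `g`, for each free ultrafilter `u`
    (∀ u : Ultrafilter ℕ, u ∉ Set.range (pure : ℕ → Ultrafilter ℕ) →
      CompactSpace (ConnectedFSpace.K u) ∧ T2Space (ConnectedFSpace.K u) ∧
      ConnectedSpace (ConnectedFSpace.K u) ∧ ConnectedFSpace.IsFSpace (ConnectedFSpace.K u) ∧
      ¬ Dense (ConnectedFSpace.Omega (ConnectedFSpace.g u)) ∧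
      Maximal VectorLattice.IsDIndependent ({1} : Set C(ConnectedFSpace.K u, ℝ)) ∧
      ¬ VectorLattice.IsDCombination ({1} : Set C(ConnectedFSpace.K u, ℝ))
        (ConnectedFSpace.g u) ∧
      ¬ VectorLattice.IsDBasis ({1} : Set C(ConnectedFSpace.K u, ℝ))) ∧
    -- the negative answer to the problem
    ¬ (∀ (X : Type) [AddCommGroup X] [Lattice X] [IsOrderedAddMonoid X] [Module ℝ X]
        [IsOrderedModule ℝ X] (D : Set X),
        Maximal VectorLattice.IsDIndependent D → VectorLattice.IsDBasis D) := by
  have key (u : Ultrafilter ℕ) (hu : u ∉ Set.range (pure : ℕ → Ultrafilter ℕ)) :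
      CompactSpace (ConnectedFSpace.K u) ∧ T2Space (ConnectedFSpace.K u) ∧
      ConnectedSpace (ConnectedFSpace.K u) ∧ ConnectedFSpace.IsFSpace (ConnectedFSpace.K u) ∧
      ¬ Dense (ConnectedFSpace.Omega (ConnectedFSpace.g u)) ∧
      Maximal VectorLattice.IsDIndependent ({1} : Set C(ConnectedFSpace.K u, ℝ)) ∧
      ¬ VectorLattice.IsDCombination ({1} : Set C(ConnectedFSpace.K u, ℝ))
        (ConnectedFSpace.g u) ∧
      ¬ VectorLattice.IsDBasis ({1} : Set C(ConnectedFSpace.K u, ℝ)) := by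
    have hcomp : CompactSpace (ConnectedFSpace.K u) :=
      isCompact_iff_compactSpace.1 (ConnectedFSpace.isClosed_K u).isCompact
    have hconn : ConnectedSpace (ConnectedFSpace.K u) :=
      isConnected_iff_connectedSpace.1 (ConnectedFSpace.isConnected_K u)
    have hF := ConnectedFSpace.isFSpace_of_isClosed hu (ConnectedFSpace.isClosed_K u)
      (ConnectedFSpace.K_subset_fiber u)
    have hg := ConnectedFSpace.not_dense_omega_g u
    exact ⟨hcomp, inferInstance, hconn, hF, hg,
      VectorLattice.singleton_one_of_not_dense_omega hF _ hg⟩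
  refine ⟨fun K _ _ _ _ hK g hg => VectorLattice.singleton_one_of_not_dense_omega hK g hg, key,
    fun h => ?_⟩
  have hu : Filter.hyperfilter ℕ ∉ Set.range (pure : ℕ → Ultrafilter ℕ) := by
    rintro ⟨n, hn⟩
    have : {n} ∈ Filter.hyperfilter ℕ := hn ▸ (Set.mem_singleton n : {n} ∈ (pure n : Ultrafilter ℕ))
    exact (Set.finite_singleton n).notMem_hyperfilter this
  obtain ⟨-, -, -, -, -, hmax, -, hnot⟩ := key _ hu
  have : IsOrderedAddMonoid C(ConnectedFSpace.K (Filter.hyperfilter ℕ), ℝ) :=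
    { add_le_add_left := fun a b hab c p => add_le_add_left (hab p) (c p) }
  have : IsOrderedModule ℝ C(ConnectedFSpace.K (Filter.hyperfilter ℕ), ℝ) :=
    { smul_le_smul_of_nonneg_left := fun c hc a b hab p => mul_le_mul_of_nonneg_left (hab p) hc
      smul_le_smul_of_nonneg_right := fun a ha c d hcd p =>
        mul_le_mul_of_nonneg_right hcd (ha p) }
  exact hnot (h _ _ hmax)
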